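/- Let $d\ge 1$, let $A,B\in\mathbb R^{d\times d}$ be symmetric positive-definite, and let $\mu=N_d(A)$, $\nu=N_d(B)$ be the centered Gaussian measures on $\mathbb R^d$ with covariance matrices $A$ and $B$. Let $\Sigma\in\mathbb R^{2d\times 2d}$ be symmetric positive-definite, with $d\times d$ blocks $$\Sigma=\begin{pmatrix}A_{\rm ref}&C_{\rm ref}\\ C_{\rm ref}^T&B_{\rm ref}\end{pmatrix},\qquad \Gamma:=\Sigma^{-1}=\begin{pmatrix}\Gamma_{11}&\Gamma_{12}\\ \Gamma_{12}^T&\Gamma_{22}\end{pmatrix},$$ and let $\varepsilon>0$. Define the entropic optimal transport cost $$W_\Sigma^\varepsilon(\mu,\nu):=\inf_{\pi\in\Pi(\mu,\nu)}\left\{\int_{\mathbb R^d\times\mathbb R^d}\|x-y\|^2\,d\pi(x,y)+2\varepsilon\,\mathrm{KL}\big(\pi\,|\,N_{2d}(\Sigma)\big)\right\},$$ where $\Pi(\mu,\nu)$ is the set of all probability measures on $\mathbb R^d\times\mathbb R^d$ with marginals $\mu$ and $\nu$, $N_{2d}(\Sigma)$ is the centered Gaussian measure with covariance $\Sigma$,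 and $\mathrm{KL}(\pi|\rho)=\int\log\frac{d\pi}{d\rho}\,d\pi$ if $\pi\ll\rho$ and $+\infty$ otherwise. Put $M_\varepsilon:=I_d-\varepsilon\Gamma_{12}$ and $$\Big(AM_\varepsilon BM_\varepsilon^T+\tfrac{\varepsilon^2}{4}I_d\Big)^{1/2}:=A^{1/2}\Big(A^{1/2}M_\varepsilon BM_\varepsilon^TA^{1/2}+\tfrac{\varepsilon^2}{4}I_d\Big)^{1/2}A^{-1/2},$$ the roots on the right being the positive-semidefinite ones. Then $W_\Sigma^\varepsilon(\mu,\nu)$ is finite and $$\begin{aligned}W_\Sigma^{\varepsilon}(\mu,\nu)={}&\operatorname{tr}A+\operatorname{tr}B-2\operatorname{tr}\Big(\big(AM_\varepsilon BM_\varepsilon^T+\tfrac{\varepsilon^2}{4}I_d\big)^{1/2}\Big)+\varepsilon\log\det\Big(\big(AM_\varepsilon BM_\varepsilon^T+\tfrac{\varepsilon^2}{4}I_d\big)^{1/2}+\tfrac{\varepsilon}{2}I_d\Big)\\&+\varepsilon\operatorname{tr}(\Gamma_{11}A)+\varepsilon\operatorname{tr}(\Gamma_{22}B)-\varepsilon\log\det(AB)-\varepsilon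 d-\varepsilon d\log\varepsilon-\varepsilon\log\det(\Sigma^{-1}).\end{aligned}$$ Moreover $$M_\varepsilon=I_d+\varepsilon A_{\rm ref}^{-1}C_{\rm ref}\big(B_{\rm ref}-C_{\rm ref}^TA_{\rm ref}^{-1}C_{\rm ref}\big)^{-1}.$$ -/

import Mathlib

open MeasureTheory ProbabilityTheory InformationTheory
open scoped ENNReal Matrix MatrixOrder

noncomputable section

namespace GaussianEOT

/-- The ambient Euclidean space `ℝ^d`. -/
abbrev Space (d : ℕ) : Type := EuclideanSpace ℝ (Fin d)

/-- The set `Π(μ, ν)` of couplings: probability measures on `ℝ^d × ℝ^d` with first marginal `μ`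
and second marginal `ν`. -/
def couplings {d : ℕ} (μ ν : Measure (Space d)) : Set (Measure (Space d × Space d)) :=
  {π | IsProbabilityMeasure π ∧ π.map Prod.fst = μ ∧ π.map Prod.snd = ν}

/-- The centered Gaussian measure `N_d(A)` on `ℝ^d` with covariance matrix `A`. -/
def gaussian {d : ℕ} (A : Matrix (Fin d) (Fin d) ℝ) : Measure (Space d) :=
  multivariateGaussian 0 A

/-- The centered Gaussian measure `N_{2d}(S)` on `ℝ^d × ℝ^d` whose covariance matrix is the
`2d × 2d` block matrix `S`; the first `d` coordinates (`Sum.inl`) belong to the first factor and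
the last `d` coordinates (`Sum.inr`) to the second. -/
def jointGaussian {d : ℕ} (S : Matrix (Fin d ⊕ Fin d) (Fin d ⊕ Fin d) ℝ) :
    Measure (Space d × Space d) :=
  (multivariateGaussian 0 S).map
    (EuclideanSpace.sumEquivProd (𝕜 := ℝ) (ι := Fin d) (κ := Fin d))

/-- The objective `∫ ‖x - y‖² dπ(x, y) + 2 ε KL(π | N_{2d}(S))`, with values in `[0, ∞]`. -/
def objective {d : ℕ} (ε : ℝ) (S : Matrix (Fin d ⊕ Fin d) (Fin d ⊕ Fin d) ℝ)
    (π : Measure (Space d × Space d)) : ℝ≥0∞ :=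
  ∫⁻ p, ENNReal.ofReal (‖p.1 - p.2‖ ^ 2) ∂π + ENNReal.ofReal (2 * ε) * klDiv π (jointGaussian S)

/-- The entropic optimal transport cost `W_S^ε(μ, ν)`: the infimum of the objective over all
couplings of `μ` and `ν`. -/
def cost {d : ℕ} (ε : ℝ) (S : Matrix (Fin d ⊕ Fin d) (Fin d ⊕ Fin d) ℝ)
    (μ ν : Measure (Space d)) : ℝ≥0∞ :=
  ⨅ π ∈ couplings μ ν, objective ε S π

/-- The matrix `M_ε = I_d - ε Γ₁₂`, where `Γ₁₂` is the upper right block of `Γ = S⁻¹`. -/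
def Meps {d : ℕ} (ε : ℝ) (S : Matrix (Fin d ⊕ Fin d) (Fin d ⊕ Fin d) ℝ) :
    Matrix (Fin d) (Fin d) ℝ :=
  1 - ε • (S⁻¹).toBlocks₁₂

/-- The matrix `(A M B Mᵀ + (ε² / 4) I_d)^{1/2}`, which for a not necessarily symmetric
`A M B Mᵀ` is defined as
`A^{1/2} (A^{1/2} M B Mᵀ A^{1/2} + (ε² / 4) I_d)^{1/2} A^{-1/2}`;
the square roots in this formula are those of positive semidefinite matrices. -/
def regRoot {d : ℕ} (ε : ℝ) (A B M : Matrix (Fin d) (Fin d) ℝ) : Matrix (Fin d) (Fin d) ℝ :=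
  CFC.sqrt A * CFC.sqrt (CFC.sqrt A * M * B * Mᵀ * CFC.sqrt A + (ε ^ 2 / 4) • 1) * (CFC.sqrt A)⁻¹

end GaussianEOT

end

/-!
Let `T` be a covariance matrix with diagonal blocks `A` and `B` such that the upper right block of
`T⁻¹` is `-ε⁻¹ M_ε`. The Gaussian `N(T)` is `N(Σ)` tilted by the quadratic form
`g(z) = ⟨z, (Σ⁻¹ - T⁻¹) z⟩ / 2`, and the cross terms of `2 ε g` cancel those of `‖x - y‖²`. Thus
`‖x - y‖² + 2 ε g` is the sum of a function of `x` and a function of `y`, so its integral is the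
same for all couplings, and the change of reference measure from `N(Σ)` to `N(T)` in the relative
entropy turns the objective of `π` into that of `N(T)` plus `2 ε KL(π | N(T))`. Hence `N(T)` is
optimal.

To find `T`, let `y ∼ N(B)` and `x | y ∼ N(K M_ε y, ε K)`. The joint precision matrix has the
required upper right block for every positive definite `K`, and `x` has covariance `A` when
`K M_ε B M_εᵀ K + ε K = A`. With `K = X⁻¹ A` this becomes `X (X - ε I) = A M_ε B M_εᵀ`, which is
solved by completing the square.
-/

namespace GaussianEOT

open Matrix
open Real (exp log)

section Tilting

variable {α β : Type*} {mα : MeasurableSpace α} {mβ : MeasurableSpace β}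

lemma map_tilted_comp (μ : Measure α) {f : α → β} (hf : Measurable f) {g : β → ℝ}
    (hg : Measurable g) : (μ.tilted (g ∘ f)).map f = (μ.map f).tilted g := by
  have hnorm : ∫ y, exp (g y) ∂(μ.map f) = ∫ x, exp (g (f x)) ∂μ :=
    integral_map hf.aemeasurable (by fun_prop)
  ext s hs
  rw [Measure.map_apply hf hs, tilted_apply' _ _ (hf hs), tilted_apply' _ _ hs,
    setLIntegral_map hs (by fun_prop) hf, hnorm]
  rfl

lemma smul_tilted (μ : Measure α) {c : ℝ≥0∞} (hc : c ≠ 0) (hc' : c ≠ ∞) (g : α → ℝ) :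
    (c • μ).tilted g = μ.tilted g := by
  have hc0 : 0 < c.toReal := ENNReal.toReal_pos hc hc'
  rw [Measure.tilted, withDensity_smul_measure, ← withDensity_smul' _ _ hc', Measure.tilted]
  congr 1
  ext x
  rw [integral_smul_measure, Pi.smul_apply, smul_eq_mul, smul_eq_mul,
    ← ENNReal.ofReal_toReal hc', ENNReal.toReal_ofReal hc0.le, ← ENNReal.ofReal_mul hc0.le,
    div_mul_eq_div_div_swap, mul_div_cancel₀ _ hc0.ne']

end Tilting

section KullbackLeibler

lemma klDiv_map_measurableEquiv {α β : Type*} {mα : MeasurableSpace α} {mβ : MeasurableSpace β}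
    (μ ν : Measure α) [IsFiniteMeasure μ] [IsFiniteMeasure ν] (e : α ≃ᵐ β) :
    klDiv (μ.map e) (ν.map e) = klDiv μ ν := by
  refine le_antisymm (klDiv_map_le μ ν e.measurable) ?_
  simpa only [MeasurableEquiv.map_symm_map] using
    klDiv_map_le (μ.map e) (ν.map e) e.symm.measurable

variable {α : Type*} {mα : MeasurableSpace α} {π ρ : Measure α} [IsProbabilityMeasure π]
  [IsProbabilityMeasure ρ] {g : α → ℝ}

lemma klDiv_tilted_right_ne_top (hgπ : Integrable g π) (hgρ : Integrable (fun x ↦ exp (g x)) ρ)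
    (h : klDiv π ρ ≠ ∞) : klDiv π (ρ.tilted g) ≠ ∞ := by
  obtain ⟨hac, hint⟩ := klDiv_ne_top_iff.1 h
  exact klDiv_ne_top (hac.trans (absolutelyContinuous_tilted hgρ))
    (integrable_llr_tilted_right hac hgπ hint hgρ)

lemma klDiv_tilted_right_eq_top_iff (hgπ : Integrable g π)
    (hgρ : Integrable (fun x ↦ exp (g x)) ρ) : klDiv π (ρ.tilted g) = ∞ ↔ klDiv π ρ = ∞ := by
  refine not_iff_not.1 ⟨fun h ↦ ?_, klDiv_tilted_right_ne_top hgπ hgρ⟩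
  have := isProbabilityMeasure_tilted hgρ
  have hneg : Integrable (fun x ↦ exp ((-g) x)) (ρ.tilted g) := by
    rw [integrable_tilted_iff hgρ]
    simp [← Real.exp_add]
  simpa [tilted_neg_same hgρ] using klDiv_tilted_right_ne_top hgπ.neg hneg h

lemma toReal_klDiv_tilted_right (hgπ : Integrable g π) (hgρ : Integrable (fun x ↦ exp (g x)) ρ)
    (h : klDiv π ρ ≠ ∞) :
    (klDiv π (ρ.tilted g)).toReal =
      (klDiv π ρ).toReal - ∫ x, g x ∂π + log (∫ x, exp (g x) ∂ρ) := by
  have := isProbabilityMeasure_tilted hgρ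
  obtain ⟨hac, hint⟩ := klDiv_ne_top_iff.1 h
  rw [toReal_klDiv_of_measure_eq hac (by simp),
    toReal_klDiv_of_measure_eq (hac.trans (absolutelyContinuous_tilted hgρ)) (by simp),
    integral_llr_tilted_right hac hgπ hgρ hint]

lemma klDiv_tilted_self_ne_top (hgρ : Integrable (fun x ↦ exp (g x)) ρ)
    (hg : Integrable g (ρ.tilted g)) : klDiv (ρ.tilted g) ρ ≠ ∞ := by
  have := isProbabilityMeasure_tilted hgρ
  rw [Ne, ← klDiv_tilted_right_eq_top_iff hg hgρ, klDiv_self]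
  exact ENNReal.zero_ne_top

lemma toReal_klDiv_tilted_self (hgρ : Integrable (fun x ↦ exp (g x)) ρ)
    (hg : Integrable g (ρ.tilted g)) :
    (klDiv (ρ.tilted g) ρ).toReal = ∫ x, g x ∂(ρ.tilted g) - log (∫ x, exp (g x) ∂ρ) := by
  have := isProbabilityMeasure_tilted hgρ
  have h := toReal_klDiv_tilted_right hg hgρ (klDiv_tilted_self_ne_top hgρ hg)
  rw [klDiv_self, ENNReal.toReal_zero] at h
  linarith

lemma lintegral_add_klDiv_eq_add_klDiv_tilted {c : α → ℝ} (hc : 0 ≤ c) {r : ℝ} (hr : 0 < r)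
    (hgρ : Integrable (fun x ↦ exp (g x)) ρ) (hcπ : Integrable c π) (hgπ : Integrable g π)
    (hcg : Integrable c (ρ.tilted g)) (hgg : Integrable g (ρ.tilted g))
    (heq : ∫ x, (c x + r * g x) ∂π = ∫ x, (c x + r * g x) ∂(ρ.tilted g)) :
    ∫⁻ x, ENNReal.ofReal (c x) ∂π + ENNReal.ofReal r * klDiv π ρ =
      ∫⁻ x, ENNReal.ofReal (c x) ∂(ρ.tilted g) + ENNReal.ofReal r * klDiv (ρ.tilted g) ρ +
        ENNReal.ofReal r * klDiv π (ρ.tilted g) := by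
  by_cases hfin : klDiv π ρ = ∞
  · simp [hfin, (klDiv_tilted_right_eq_top_iff hgπ hgρ).2 hfin, hr]
  have hπ := toReal_klDiv_tilted_right hgπ hgρ hfin
  have hself := toReal_klDiv_tilted_self hgρ hgg
  rw [integral_add hcπ (hgπ.const_mul r), integral_add hcg (hgg.const_mul r),
    integral_const_mul, integral_const_mul] at heq
  rw [← ofReal_integral_eq_lintegral_ofReal hcπ (ae_of_all _ hc),
    ← ofReal_integral_eq_lintegral_ofReal hcg (ae_of_all _ hc),
    ← ENNReal.ofReal_toReal hfin, ← ENNReal.ofReal_toReal (klDiv_tilted_self_ne_top hgρ hgg),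
    ← ENNReal.ofReal_toReal (klDiv_tilted_right_ne_top hgπ hgρ hfin)]
  have hcπ0 : 0 ≤ ∫ x, c x ∂π := integral_nonneg hc
  have hcg0 : 0 ≤ ∫ x, c x ∂(ρ.tilted g) := integral_nonneg hc
  simp only [← ENNReal.ofReal_mul hr.le]
  repeat rw [← ENNReal.ofReal_add (by positivity) (by positivity)]
  congr 1
  linear_combination heq - r * hπ - r * hself

end KullbackLeibler

section QuadraticForms

variable {ι κ : Type*} [Fintype ι] [Fintype κ]

/-- The quadratic form `x ↦ ⟨x, P x⟩` of a real matrix `P`, as a function on Euclidean space, where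
it serves as a log-density of Gaussian measures. -/
noncomputable def quadForm (P : Matrix ι ι ℝ) (x : EuclideanSpace ℝ ι) : ℝ := x.ofLp ⬝ᵥ P *ᵥ x.ofLp

@[fun_prop]
lemma measurable_quadForm (P : Matrix ι ι ℝ) : Measurable (quadForm P) := by
  unfold quadForm
  fun_prop

lemma quadForm_eq_sum (P : Matrix ι ι ℝ) (x : EuclideanSpace ℝ ι) :
    quadForm P x = ∑ i, ∑ j, P i j * (x j * x i) := by
  simp only [quadForm, dotProduct, mulVec, Finset.mul_sum]
  exact Finset.sum_congr rfl fun i _ ↦ Finset.sum_congr rfl fun j _ ↦ by ring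

lemma quadForm_add (P Q : Matrix ι ι ℝ) (x : EuclideanSpace ℝ ι) :
    quadForm (P + Q) x = quadForm P x + quadForm Q x := by
  simp only [quadForm, add_mulVec, dotProduct_add]

lemma quadForm_sub (P Q : Matrix ι ι ℝ) (x : EuclideanSpace ℝ ι) :
    quadForm (P - Q) x = quadForm P x - quadForm Q x := by
  simp only [quadForm, sub_mulVec, dotProduct_sub]

lemma quadForm_smul (c : ℝ) (P : Matrix ι ι ℝ) (x : EuclideanSpace ℝ ι) :
    quadForm (c • P) x = c * quadForm P x := by
  simp only [quadForm, smul_mulVec, dotProduct_smul, smul_eq_mul]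

lemma quadForm_one [DecidableEq ι] (x : EuclideanSpace ℝ ι) : quadForm 1 x = ‖x‖ ^ 2 := by
  rw [quadForm, one_mulVec, EuclideanSpace.real_norm_sq_eq, dotProduct]
  simp only [sq]

lemma quadForm_toEuclideanCLM [DecidableEq ι] (P T : Matrix ι ι ℝ) (x : EuclideanSpace ℝ ι) :
    quadForm P (toEuclideanCLM (𝕜 := ℝ) T x) = quadForm (Tᵀ * P * T) x := by
  simp only [quadForm, ofLp_toEuclideanCLM, mulVec_mulVec, dotProduct_mulVec, ← mulVec_transpose,
    transpose_mul, transpose_transpose, mul_assoc]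

lemma integrable_quadForm {μ : Measure (EuclideanSpace ℝ ι)} (hμ : MemLp id 2 μ)
    (P : Matrix ι ι ℝ) : Integrable (quadForm P) μ := by
  have hcoord (i : ι) : MemLp (fun x : EuclideanSpace ℝ ι ↦ x i) 2 μ :=
    (EuclideanSpace.proj (𝕜 := ℝ) i).comp_memLp' hμ
  simp only [funext (quadForm_eq_sum P)]
  exact integrable_finsetSum _ fun i _ ↦ integrable_finsetSum _ fun j _ ↦
    ((hcoord j).integrable_mul (hcoord i)).const_mul _

lemma integral_quadForm_multivariateGaussian [DecidableEq ι] {S : Matrix ι ι ℝ}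
    (hS : S.PosSemidef) (P : Matrix ι ι ℝ) :
    ∫ x, quadForm P x ∂(multivariateGaussian 0 S) = (P * S).trace := by
  have hcoord (i : ι) : MemLp (fun x : EuclideanSpace ℝ ι ↦ x i) 2 (multivariateGaussian 0 S) :=
    (EuclideanSpace.proj (𝕜 := ℝ) i).comp_memLp' IsGaussian.memLp_two_id
  have hint (i j : ι) : Integrable (fun x : EuclideanSpace ℝ ι ↦ x i * x j)
      (multivariateGaussian 0 S) := (hcoord i).integrable_mul (hcoord j)
  have hmean (i : ι) : ∫ x : EuclideanSpace ℝ ι, x i ∂(multivariateGaussian 0 S) = 0 := by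
    simpa using (EuclideanSpace.proj (𝕜 := ℝ) i).integral_comp_id_comm
      (μ := multivariateGaussian 0 S) IsGaussian.integrable_id
  have hcov (i j : ι) : ∫ x : EuclideanSpace ℝ ι, x i * x j ∂(multivariateGaussian 0 S) =
      S i j := by
    simpa [covariance_eval_multivariateGaussian hS, hmean] using
      (covariance_eq_sub (hcoord i) (hcoord j)).symm
  have hterm (i j : ι) : Integrable (fun x : EuclideanSpace ℝ ι ↦ P i j * (x j * x i))
      (multivariateGaussian 0 S) := (hint j i).const_mul (P i j)
  calc ∫ x, quadForm P x ∂(multivariateGaussian 0 S)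
      = ∑ i, ∑ j, P i j * ∫ x : EuclideanSpace ℝ ι, x j * x i ∂(multivariateGaussian 0 S) := by
        simp only [quadForm_eq_sum, ← integral_const_mul]
        rw [integral_finsetSum _ fun i _ ↦ integrable_finsetSum _ fun j _ ↦ hterm i j]
        exact Finset.sum_congr rfl fun i _ ↦ integral_finsetSum _ fun j _ ↦ hterm i j
    _ = (P * S).trace := by simp only [hcov, trace, diag_apply, mul_apply]

/-- The quadratic form of a block matrix on the product of two Euclidean spaces. It is stated on
the product, and not on `EuclideanSpace ℝ (ι ⊕ κ)`, because couplings are measures on products. -/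
noncomputable def prodQuadForm (K : Matrix (ι ⊕ κ) (ι ⊕ κ) ℝ)
    (p : EuclideanSpace ℝ ι × EuclideanSpace ℝ κ) : ℝ :=
  quadForm K (EuclideanSpace.sumEquivProd.symm p)

@[fun_prop]
lemma measurable_prodQuadForm (K : Matrix (ι ⊕ κ) (ι ⊕ κ) ℝ) : Measurable (prodQuadForm K) := by
  unfold prodQuadForm
  fun_prop

lemma prodQuadForm_eq (K : Matrix (ι ⊕ κ) (ι ⊕ κ) ℝ)
    (p : EuclideanSpace ℝ ι × EuclideanSpace ℝ κ) :
    prodQuadForm K p = quadForm K.toBlocks₁₁ p.1 + p.1.ofLp ⬝ᵥ K.toBlocks₁₂ *ᵥ p.2.ofLp +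
      p.2.ofLp ⬝ᵥ K.toBlocks₂₁ *ᵥ p.1.ofLp + quadForm K.toBlocks₂₂ p.2 := by
  have hsum : (EuclideanSpace.sumEquivProd.symm p).ofLp = Sum.elim p.1.ofLp p.2.ofLp := by
    ext i
    cases i <;> rfl
  nth_rewrite 1 [prodQuadForm, ← fromBlocks_toBlocks K]
  rw [quadForm, hsum, fromBlocks_mulVec, sumElim_dotProduct_sumElim]
  simp only [Sum.elim_comp_inl, Sum.elim_comp_inr, dotProduct_add, quadForm]
  ring

lemma prodQuadForm_eq_add_of_toBlocks_eq_zero {K : Matrix (ι ⊕ κ) (ι ⊕ κ) ℝ}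
    (h₁₂ : K.toBlocks₁₂ = 0) (h₂₁ : K.toBlocks₂₁ = 0)
    (p : EuclideanSpace ℝ ι × EuclideanSpace ℝ κ) :
    prodQuadForm K p = quadForm K.toBlocks₁₁ p.1 + quadForm K.toBlocks₂₂ p.2 := by
  simp only [prodQuadForm_eq, h₁₂, h₂₁, zero_mulVec, dotProduct_zero, add_zero]

lemma norm_sub_sq_eq_prodQuadForm [DecidableEq ι] (p : EuclideanSpace ℝ ι × EuclideanSpace ℝ ι) :
    ‖p.1 - p.2‖ ^ 2 = prodQuadForm (fromBlocks 1 (-1) (-1) 1) p := by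
  rw [norm_sub_sq_real, prodQuadForm_eq]
  simp only [toBlocks_fromBlocks₁₁, toBlocks_fromBlocks₁₂, toBlocks_fromBlocks₂₁,
    toBlocks_fromBlocks₂₂, quadForm_one, neg_mulVec, neg_dotProduct, one_mulVec, dotProduct_neg,
    EuclideanSpace.inner_eq_star_dotProduct, star_trivial, dotProduct_comm p.2.ofLp]
  ring

lemma integrable_prodQuadForm {π : Measure (EuclideanSpace ℝ ι × EuclideanSpace ℝ κ)}
    (hπ : MemLp id 2 π) (K : Matrix (ι ⊕ κ) (ι ⊕ κ) ℝ) : Integrable (prodQuadForm K) π := by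
  let e := (EuclideanSpace.sumEquivProd (𝕜 := ℝ) (ι := ι) (κ := κ)).symm
  have he : Measurable e := by fun_prop
  have hmap : MemLp id 2 (π.map e) :=
    (memLp_map_measure_iff (by fun_prop) he.aemeasurable).2
      (e.toContinuousLinearMap.comp_memLp' hπ)
  exact (integrable_quadForm hmap K).comp_measurable he

end QuadraticForms

section GaussianDensity

lemma stdGaussian_eq_tilted_volume (E : Type*) [NormedAddCommGroup E] [InnerProductSpace ℝ E]
    [FiniteDimensional ℝ E] [MeasurableSpace E] [BorelSpace E] :
    stdGaussian E = (volume : Measure E).tilted fun x ↦ -(1 / 2) * ‖x‖ ^ 2 := by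
  have hb : (0 : ℝ) < ((1 / 2 : ℝ) : ℂ).re := by norm_num
  have hnorm := GaussianFourier.integral_rexp_neg_mul_sq_norm (V := E) (b := 1 / 2) (by norm_num)
  have hint : Integrable (fun x : E ↦ exp (-(1 / 2) * ‖x‖ ^ 2)) :=
    .of_integral_ne_zero (by rw [hnorm]; positivity)
  have := isProbabilityMeasure_tilted hint
  refine Measure.ext_of_charFun (funext fun t ↦ ?_)
  have hnormC := GaussianFourier.integral_cexp_neg_mul_sq_norm (V := E) hb
  have hfourier := GaussianFourier.integral_cexp_neg_mul_sq_norm_add hb Complex.I t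
  have hpos : ((∫ x : E, exp (-(1 / 2) * ‖x‖ ^ 2) : ℝ) : ℂ) ≠ 0 := by
    rw [hnorm]
    exact_mod_cast (by positivity : (0 : ℝ) < _).ne'
  have hcast : ((∫ x : E, exp (-(1 / 2) * ‖x‖ ^ 2) : ℝ) : ℂ) =
      (Real.pi / ((1 / 2 : ℝ) : ℂ)) ^ (Module.finrank ℝ E / 2 : ℂ) := by
    rw [← hnormC, ← integral_complex_ofReal]
    simp only [Complex.ofReal_exp, Complex.ofReal_mul, Complex.ofReal_neg, Complex.ofReal_pow]
  rw [charFun_stdGaussian, charFun_apply, integral_tilted]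
  calc Complex.exp (-‖t‖ ^ 2 / 2)
      = (∫ x : E, Complex.exp (-((1 / 2 : ℝ) : ℂ) * ‖x‖ ^ 2 + Complex.I * inner ℝ t x)) /
          ((∫ x : E, exp (-(1 / 2) * ‖x‖ ^ 2) : ℝ) : ℂ) := by
        rw [hfourier, ← hcast, mul_div_cancel_left₀ _ hpos, Complex.I_sq]
        push_cast
        ring_nf
    _ = _ := by
        rw [← integral_div]
        refine integral_congr_ae (ae_of_all _ fun x ↦ ?_)
        simp only [Complex.real_smul, real_inner_comm, Complex.ofReal_div, Complex.exp_add]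
        push_cast
        ring_nf

variable {ι : Type*} [Fintype ι] [DecidableEq ι]

lemma posDef_sqrt {A : Matrix ι ι ℝ} (hA : A.PosDef) : (CFC.sqrt A).PosDef :=
  isStrictlyPositive_iff_posDef.1 (isStrictlyPositive_iff_posDef.2 hA).sqrt

lemma transpose_sqrt (A : Matrix ι ι ℝ) : (CFC.sqrt A)ᵀ = CFC.sqrt A :=
  (nonneg_iff_posSemidef.1 (CFC.sqrt_nonneg A)).isHermitian

lemma isUnit_det_sqrt {A : Matrix ι ι ℝ} (hA : A.PosDef) : IsUnit (CFC.sqrt A).det :=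
  (isUnit_iff_isUnit_det _).1 (posDef_sqrt hA).isUnit

lemma map_toEuclideanCLM_volume {T : Matrix ι ι ℝ} (hT : T.det ≠ 0) :
    (volume : Measure (EuclideanSpace ℝ ι)).map (toEuclideanCLM (𝕜 := ℝ) T) =
      ENNReal.ofReal |T.det⁻¹| • volume := by
  have hdet : LinearMap.det (toEuclideanCLM (𝕜 := ℝ) T : EuclideanSpace ℝ ι →ₗ[ℝ] _) = T.det :=
    LinearMap.det_toLin (PiLp.basisFun 2 ℝ ι) T
  rw [← hdet] at hT ⊢
  exact Measure.map_linearMap_addHaar_eq_smul_addHaar _ hT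

lemma integral_exp_neg_quadForm {P : Matrix ι ι ℝ} (hP : P.PosDef) :
    ∫ x, exp (-(quadForm P x / 2)) = (2 * Real.pi) ^ (Fintype.card ι / 2 : ℝ) / √P.det := by
  have hdet : (CFC.sqrt P).det = √P.det :=
    hP.posSemidef.det_sqrt.trans RCLike.sqrt_real
  have hdet0 : (CFC.sqrt P).det ≠ 0 := (isUnit_det_sqrt hP).ne_zero
  have hform (x : EuclideanSpace ℝ ι) :
      -(quadForm P x / 2) = -(1 / 2) * ‖toEuclideanCLM (𝕜 := ℝ) (CFC.sqrt P) x‖ ^ 2 := by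
    rw [← quadForm_one, quadForm_toEuclideanCLM, transpose_sqrt, mul_one,
      CFC.sqrt_mul_sqrt_self P hP.posSemidef.nonneg]
    ring
  have hchange := integral_map (μ := volume)
    (φ := toEuclideanCLM (𝕜 := ℝ) (CFC.sqrt P)) (by fun_prop)
    (f := fun y : EuclideanSpace ℝ ι ↦ exp (-(1 / 2) * ‖y‖ ^ 2)) (by fun_prop)
  simp only [hform]
  rw [← hchange, map_toEuclideanCLM_volume hdet0, integral_smul_measure,
    GaussianFourier.integral_rexp_neg_mul_sq_norm (by norm_num), hdet,
    ENNReal.toReal_ofReal (by positivity), abs_of_nonneg (by positivity), finrank_euclideanSpace,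
    smul_eq_mul, inv_mul_eq_div, div_div_eq_mul_div, div_one, mul_comm Real.pi]

omit [DecidableEq ι] in
lemma integrable_exp_neg_quadForm {P : Matrix ι ι ℝ} (hP : P.PosDef) :
    Integrable fun x ↦ exp (-(quadForm P x / 2)) := by
  classical
  have hdet := hP.det_pos
  exact .of_integral_ne_zero (by rw [integral_exp_neg_quadForm hP]; positivity)

lemma multivariateGaussian_eq_tilted_volume {S : Matrix ι ι ℝ} (hS : S.PosDef) :
    multivariateGaussian 0 S = volume.tilted fun x ↦ -(quadForm S⁻¹ x / 2) := by
  have hdet := (isUnit_det_sqrt hS).ne_zero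
  have hwhiten : (CFC.sqrt S)ᵀ * S⁻¹ * CFC.sqrt S = 1 := by
    nth_rewrite 2 [← CFC.sqrt_mul_sqrt_self S hS.posSemidef.nonneg]
    rw [transpose_sqrt, Matrix.mul_inv_rev, ← mul_assoc, mul_nonsing_inv _ (isUnit_det_sqrt hS),
      one_mul, nonsing_inv_mul _ (isUnit_det_sqrt hS)]
  have hform : (fun x : EuclideanSpace ℝ ι ↦ -(1 / 2) * ‖x‖ ^ 2) =
      (fun x ↦ -(quadForm S⁻¹ x / 2)) ∘ toEuclideanCLM (𝕜 := ℝ) (CFC.sqrt S) := by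
    ext x
    rw [Function.comp_apply, quadForm_toEuclideanCLM, hwhiten, quadForm_one]
    ring
  simp only [multivariateGaussian, zero_add]
  rw [stdGaussian_eq_tilted_volume, hform, map_tilted_comp _ (by fun_prop) (by fun_prop),
    map_toEuclideanCLM_volume hdet, smul_tilted _ (by simpa using hdet) ENNReal.ofReal_ne_top]

variable {S T : Matrix ι ι ℝ}

lemma multivariateGaussian_eq_tilted (hS : S.PosDef) (hT : T.PosDef) :
    multivariateGaussian 0 T =
      (multivariateGaussian 0 S).tilted fun x ↦ quadForm (S⁻¹ - T⁻¹) x / 2 := by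
  rw [multivariateGaussian_eq_tilted_volume hS, multivariateGaussian_eq_tilted_volume hT,
    tilted_tilted (integrable_exp_neg_quadForm hS.inv)]
  congr 1
  ext x
  rw [Pi.add_apply, quadForm_sub]
  ring

lemma integral_exp_quadForm_multivariateGaussian (hS : S.PosDef) (hT : T.PosDef) :
    ∫ x, exp (quadForm (S⁻¹ - T⁻¹) x / 2) ∂(multivariateGaussian 0 S) = √T.det / √S.det := by
  have hS0 := hS.det_pos
  have hT0 := hT.det_pos
  have hsum : (fun x ↦ -(quadForm S⁻¹ x / 2)) + (fun x ↦ quadForm (S⁻¹ - T⁻¹) x / 2) =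
      fun x ↦ -(quadForm T⁻¹ x / 2) := by
    ext x
    rw [Pi.add_apply, quadForm_sub]
    ring
  rw [multivariateGaussian_eq_tilted_volume hS, integral_exp_tilted, hsum,
    integral_exp_neg_quadForm hS.inv, integral_exp_neg_quadForm hT.inv]
  simp only [det_nonsing_inv, Ring.inverse_eq_inv', Real.sqrt_inv]
  field_simp

lemma integrable_exp_quadForm_multivariateGaussian (hS : S.PosDef) (hT : T.PosDef) :
    Integrable (fun x ↦ exp (quadForm (S⁻¹ - T⁻¹) x / 2)) (multivariateGaussian 0 S) := by
  have hS0 := hS.det_pos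
  have hT0 := hT.det_pos
  exact .of_integral_ne_zero
    (by rw [integral_exp_quadForm_multivariateGaussian hS hT]; positivity)

lemma klDiv_multivariateGaussian_ne_top (hS : S.PosDef) (hT : T.PosDef) :
    klDiv (multivariateGaussian 0 T) (multivariateGaussian 0 S) ≠ ∞ := by
  rw [multivariateGaussian_eq_tilted hS hT]
  refine klDiv_tilted_self_ne_top (integrable_exp_quadForm_multivariateGaussian hS hT) ?_
  rw [← multivariateGaussian_eq_tilted hS hT]
  exact (integrable_quadForm IsGaussian.memLp_two_id _).div_const 2

lemma toReal_klDiv_multivariateGaussian (hS : S.PosDef) (hT : T.PosDef) :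
    (klDiv (multivariateGaussian 0 T) (multivariateGaussian 0 S)).toReal =
      ((S⁻¹ * T).trace - Fintype.card ι + log S.det - log T.det) / 2 := by
  have hint : Integrable (fun x ↦ quadForm (S⁻¹ - T⁻¹) x / 2) (multivariateGaussian 0 T) :=
    (integrable_quadForm IsGaussian.memLp_two_id _).div_const 2
  have hTu : IsUnit T.det := (isUnit_iff_isUnit_det _).1 hT.isUnit
  have hkl := toReal_klDiv_tilted_self (integrable_exp_quadForm_multivariateGaussian hS hT)
    (multivariateGaussian_eq_tilted hS hT ▸ hint)
  rw [← multivariateGaussian_eq_tilted hS hT, integral_div,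
    integral_quadForm_multivariateGaussian hT.posSemidef,
    integral_exp_quadForm_multivariateGaussian hS hT,
    Real.log_div (Real.sqrt_ne_zero'.2 hT.det_pos) (Real.sqrt_ne_zero'.2 hS.det_pos),
    Real.log_sqrt hT.det_pos.le, Real.log_sqrt hS.det_pos.le, sub_mul, trace_sub,
    nonsing_inv_mul _ hTu, trace_one] at hkl
  linarith

end GaussianDensity

section JointGaussian

lemma map_multivariateGaussian_of_apply_eq {ι κ : Type*} [Fintype ι] [DecidableEq ι] [Fintype κ]
    [DecidableEq κ] {S : Matrix ι ι ℝ} (hS : S.PosSemidef) (f : κ → ι)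
    (L : EuclideanSpace ℝ ι →L[ℝ] EuclideanSpace ℝ κ) (hL : ∀ x k, L x k = x (f k)) :
    (multivariateGaussian 0 S).map L = multivariateGaussian 0 (S.submatrix f f) := by
  apply IsGaussian.ext
  · simp only [id_eq, integral_id_multivariateGaussian]
    rw [ContinuousLinearMap.integral_id_map IsGaussian.integrable_id,
      integral_id_multivariateGaussian, map_zero]
  rw [← ContinuousLinearMap.toBilinForm_inj]
  refine LinearMap.BilinForm.ext_basis (EuclideanSpace.basisFun κ ℝ).toBasis fun i j ↦ ?_
  have hcoord (i : κ) : (fun u ↦ inner ℝ ((EuclideanSpace.basisFun κ ℝ).toBasis i) u) ∘ L =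
      fun u ↦ u (f i) := by
    ext
    simp [PiLp.inner_apply, hL]
  rw [ContinuousLinearMap.toBilinForm_apply, ContinuousLinearMap.toBilinForm_apply,
    covarianceBilin_apply_eq_cov IsGaussian.memLp_two_id,
    covariance_map (by fun_prop) (by fun_prop) (by fun_prop), hcoord, hcoord,
    covariance_eval_multivariateGaussian hS, covarianceBilin_multivariateGaussian (hS.submatrix _)]
  simp

variable {d : ℕ} {S T : Matrix (Fin d ⊕ Fin d) (Fin d ⊕ Fin d) ℝ}

instance isProbabilityMeasure_jointGaussian : IsProbabilityMeasure (jointGaussian S) :=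
  Measure.isProbabilityMeasure_map (by fun_prop)

lemma jointGaussian_mem_couplings (hS : S.PosSemidef) :
    jointGaussian S ∈ couplings (gaussian S.toBlocks₁₁) (gaussian S.toBlocks₂₂) := by
  let e : EuclideanSpace ℝ (Fin d ⊕ Fin d) →L[ℝ] Space d × Space d :=
    (EuclideanSpace.sumEquivProd (𝕜 := ℝ) (ι := Fin d) (κ := Fin d)).toContinuousLinearMap
  refine ⟨inferInstance, ?_, ?_⟩ <;> rw [jointGaussian, Measure.map_map (by fun_prop) (by fun_prop)]
  · exact map_multivariateGaussian_of_apply_eq hS Sum.inl (.comp (.fst ℝ _ _) e) fun _ _ ↦ rfl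
  · exact map_multivariateGaussian_of_apply_eq hS Sum.inr (.comp (.snd ℝ _ _) e) fun _ _ ↦ rfl

lemma jointGaussian_eq_tilted (hS : S.PosDef) (hT : T.PosDef) :
    jointGaussian T = (jointGaussian S).tilted fun p ↦ prodQuadForm (S⁻¹ - T⁻¹) p / 2 := by
  rw [jointGaussian, jointGaussian, ← map_tilted_comp _ (by fun_prop) (by fun_prop),
    multivariateGaussian_eq_tilted hS hT]
  simp only [Function.comp_def, prodQuadForm, ContinuousLinearEquiv.symm_apply_apply]

lemma integrable_exp_prodQuadForm_jointGaussian (hS : S.PosDef) (hT : T.PosDef) :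
    Integrable (fun p ↦ exp (prodQuadForm (S⁻¹ - T⁻¹) p / 2)) (jointGaussian S) := by
  rw [jointGaussian, integrable_map_measure (by fun_prop) (by fun_prop)]
  simpa only [Function.comp_def, prodQuadForm, ContinuousLinearEquiv.symm_apply_apply] using
    integrable_exp_quadForm_multivariateGaussian hS hT

lemma integral_prodQuadForm_jointGaussian (hS : S.PosSemidef)
    (K : Matrix (Fin d ⊕ Fin d) (Fin d ⊕ Fin d) ℝ) :
    ∫ p, prodQuadForm K p ∂(jointGaussian S) = (K * S).trace := by
  rw [jointGaussian, integral_map (by fun_prop) (by fun_prop),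
    ← integral_quadForm_multivariateGaussian hS]
  simp only [prodQuadForm, ContinuousLinearEquiv.symm_apply_apply]

lemma klDiv_jointGaussian (S T : Matrix (Fin d ⊕ Fin d) (Fin d ⊕ Fin d) ℝ) :
    klDiv (jointGaussian T) (jointGaussian S) =
      klDiv (multivariateGaussian 0 T) (multivariateGaussian 0 S) :=
  klDiv_map_measurableEquiv _ _ EuclideanSpace.sumEquivProd.toHomeomorph.toMeasurableEquiv

end JointGaussian

section Couplings

variable {d : ℕ} {μ ν : Measure (Space d)} {π : Measure (Space d × Space d)}

lemma memLp_id_of_mem_couplings (hμ : MemLp id 2 μ) (hν : MemLp id 2 ν)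
    (hπ : π ∈ couplings μ ν) : MemLp id 2 π := by
  obtain ⟨-, rfl, rfl⟩ := hπ
  exact memLp_prod_iff.2
    ⟨hμ.comp_of_map measurable_fst.aemeasurable, hν.comp_of_map measurable_snd.aemeasurable⟩

lemma integral_prodQuadForm_eq_of_mem_couplings (hμ : MemLp id 2 μ) (hν : MemLp id 2 ν)
    (hπ : π ∈ couplings μ ν) {K : Matrix (Fin d ⊕ Fin d) (Fin d ⊕ Fin d) ℝ}
    (h₁₂ : K.toBlocks₁₂ = 0) (h₂₁ : K.toBlocks₂₁ = 0) :
    ∫ p, prodQuadForm K p ∂π =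
      ∫ x, quadForm K.toBlocks₁₁ x ∂μ + ∫ y, quadForm K.toBlocks₂₂ y ∂ν := by
  obtain ⟨-, rfl, rfl⟩ := hπ
  have hfst : Integrable (fun p : Space d × Space d ↦ quadForm K.toBlocks₁₁ p.1) π :=
    (integrable_quadForm hμ _).comp_measurable measurable_fst
  have hsnd : Integrable (fun p : Space d × Space d ↦ quadForm K.toBlocks₂₂ p.2) π :=
    (integrable_quadForm hν _).comp_measurable measurable_snd
  simp only [prodQuadForm_eq_add_of_toBlocks_eq_zero h₁₂ h₂₁]
  rw [integral_add hfst hsnd, integral_map (by fun_prop) (by fun_prop),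
    integral_map (by fun_prop) (by fun_prop)]

end Couplings

section BlockMatrices

variable {m n : Type*}

lemma toBlocks₂₁_eq_transpose_of_isHermitian {P : Matrix (m ⊕ n) (m ⊕ n) ℝ}
    (hP : P.IsHermitian) : P.toBlocks₂₁ = (P.toBlocks₁₂)ᵀ := by
  ext i j
  exact (hP.apply (Sum.inr i) (Sum.inl j)).symm

lemma fromBlocks_eq_of_isHermitian {P : Matrix (m ⊕ n) (m ⊕ n) ℝ} (hP : P.IsHermitian) :
    fromBlocks P.toBlocks₁₁ P.toBlocks₁₂ (P.toBlocks₁₂)ᵀ P.toBlocks₂₂ = P := by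
  rw [← toBlocks₂₁_eq_transpose_of_isHermitian hP, fromBlocks_toBlocks]

variable [Fintype m] [Fintype n]

lemma trace_mul_eq_add_of_isHermitian {P Q : Matrix (m ⊕ n) (m ⊕ n) ℝ}
    (hP : P.IsHermitian) (hQ : Q.IsHermitian) :
    (P * Q).trace = (P.toBlocks₁₁ * Q.toBlocks₁₁).trace + (P.toBlocks₂₂ * Q.toBlocks₂₂).trace +
      2 * (P.toBlocks₁₂ * (Q.toBlocks₁₂)ᵀ).trace := by
  have hcross : ((P.toBlocks₁₂)ᵀ * Q.toBlocks₁₂).trace =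
      (P.toBlocks₁₂ * (Q.toBlocks₁₂)ᵀ).trace := by
    rw [← trace_transpose, transpose_mul, transpose_transpose, trace_mul_comm]
  nth_rewrite 1 [← fromBlocks_eq_of_isHermitian hP, ← fromBlocks_eq_of_isHermitian hQ]
  rw [fromBlocks_multiply, trace, Fintype.sum_sum_type]
  change (_ + _ : Matrix m m ℝ).trace + (_ + _ : Matrix n n ℝ).trace = _
  rw [trace_add, trace_add, hcross]
  ring

variable [DecidableEq m] [DecidableEq n]

lemma toBlocks₁₂_inv_eq_neg_mul_inv_schur₂₂ {P : Matrix (m ⊕ n) (m ⊕ n) ℝ} (hP : P.PosDef) :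
    (P⁻¹).toBlocks₁₂ = -((P.toBlocks₁₁)⁻¹ * P.toBlocks₁₂ *
      (P.toBlocks₂₂ - (P.toBlocks₁₂)ᵀ * (P.toBlocks₁₁)⁻¹ * P.toBlocks₁₂)⁻¹) := by
  have hblocks := fromBlocks_eq_of_isHermitian hP.isHermitian
  have h₁₁ : P.toBlocks₁₁.PosDef := hP.submatrix Sum.inl_injective
  have hunit := hP.isUnit
  rw [← hblocks] at hunit
  have := hunit.invertible
  have := h₁₁.isUnit.invertible
  have := (isUnit_fromBlocks_iff_of_invertible₁₁.1 hunit).invertible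
  have hinv := congrArg toBlocks₁₂
    (invOf_fromBlocks₁₁_eq P.toBlocks₁₁ P.toBlocks₁₂ (P.toBlocks₁₂)ᵀ P.toBlocks₂₂)
  simpa only [invOf_eq_nonsing_inv, hblocks, toBlocks_fromBlocks₁₂] using hinv

lemma toBlocks₁₂_inv_eq_neg_inv_schur₁₁_mul {P : Matrix (m ⊕ n) (m ⊕ n) ℝ} (hP : P.PosDef) :
    (P⁻¹).toBlocks₁₂ = -((P.toBlocks₁₁ - P.toBlocks₁₂ * (P.toBlocks₂₂)⁻¹ * (P.toBlocks₁₂)ᵀ)⁻¹ *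
      P.toBlocks₁₂ * (P.toBlocks₂₂)⁻¹) := by
  have hblocks := fromBlocks_eq_of_isHermitian hP.isHermitian
  have h₂₂ : P.toBlocks₂₂.PosDef := hP.submatrix Sum.inr_injective
  have hunit := hP.isUnit
  rw [← hblocks] at hunit
  have := hunit.invertible
  have := h₂₂.isUnit.invertible
  have := (isUnit_fromBlocks_iff_of_invertible₂₂.1 hunit).invertible
  have hinv := congrArg toBlocks₁₂
    (invOf_fromBlocks₂₂_eq P.toBlocks₁₁ P.toBlocks₁₂ (P.toBlocks₁₂)ᵀ P.toBlocks₂₂)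
  simpa only [invOf_eq_nonsing_inv, hblocks, toBlocks_fromBlocks₁₂] using hinv

end BlockMatrices

section OptimalCoupling

variable {d : ℕ} {S T : Matrix (Fin d ⊕ Fin d) (Fin d ⊕ Fin d) ℝ} {ε : ℝ}

lemma memLp_id_gaussian (A : Matrix (Fin d) (Fin d) ℝ) : MemLp id 2 (gaussian A) :=
  IsGaussian.memLp_two_id (μ := multivariateGaussian 0 A)

lemma norm_sub_sq_add_prodQuadForm (K : Matrix (Fin d ⊕ Fin d) (Fin d ⊕ Fin d) ℝ)
    (p : Space d × Space d) :
    ‖p.1 - p.2‖ ^ 2 + 2 * ε * (prodQuadForm K p / 2) =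
      prodQuadForm (fromBlocks 1 (-1) (-1) 1 + ε • K) p := by
  rw [norm_sub_sq_eq_prodQuadForm]
  simp only [prodQuadForm, quadForm_add, quadForm_smul]
  ring

lemma objective_eq_add_klDiv (hS : S.PosDef) (hT : T.PosDef) (hε : 0 < ε)
    (hT₁₂ : (T⁻¹).toBlocks₁₂ = -(ε⁻¹ • Meps ε S)) {π : Measure (Space d × Space d)}
    (hπ : π ∈ couplings (gaussian T.toBlocks₁₁) (gaussian T.toBlocks₂₂)) :
    objective ε S π =
      objective ε S (jointGaussian T) + ENNReal.ofReal (2 * ε) * klDiv π (jointGaussian T) := by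
  have := hπ.1
  have hμ := memLp_id_gaussian T.toBlocks₁₁
  have hν := memLp_id_gaussian T.toBlocks₂₂
  have hmem := jointGaussian_mem_couplings hT.posSemidef
  have hLp := memLp_id_of_mem_couplings hμ hν hπ
  have hLp' := memLp_id_of_mem_couplings hμ hν hmem
  have h₁₂ : (fromBlocks 1 (-1) (-1) 1 + ε • (S⁻¹ - T⁻¹)).toBlocks₁₂ = 0 := by
    change -1 + ε • ((S⁻¹).toBlocks₁₂ - (T⁻¹).toBlocks₁₂) = 0
    rw [hT₁₂, Meps, sub_neg_eq_add, smul_add, smul_inv_smul₀ hε.ne']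
    abel
  have h₂₁ : (fromBlocks 1 (-1) (-1) 1 + ε • (S⁻¹ - T⁻¹)).toBlocks₂₁ = 0 := by
    have hherm : (fromBlocks 1 (-1) (-1) 1 + ε • (S⁻¹ - T⁻¹)).IsHermitian :=
      .add (.fromBlocks isHermitian_one (by simp) isHermitian_one)
        ((hS.inv.isHermitian.sub hT.inv.isHermitian).smul (.all ε))
    rw [toBlocks₂₁_eq_transpose_of_isHermitian hherm, h₁₂, transpose_zero]
  have htilt := jointGaussian_eq_tilted hS hT
  unfold objective
  rw [htilt]
  refine lintegral_add_klDiv_eq_add_klDiv_tilted (fun p ↦ by positivity) (by positivity)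
    (integrable_exp_prodQuadForm_jointGaussian hS hT) ?_
    ((integrable_prodQuadForm hLp _).div_const 2) ?_ ?_ ?_
  · simpa only [norm_sub_sq_eq_prodQuadForm] using integrable_prodQuadForm hLp _
  · simpa only [← htilt, norm_sub_sq_eq_prodQuadForm] using integrable_prodQuadForm hLp' _
  · simpa only [← htilt] using (integrable_prodQuadForm hLp' _).div_const 2
  · simp only [norm_sub_sq_add_prodQuadForm, ← htilt]
    rw [integral_prodQuadForm_eq_of_mem_couplings hμ hν hπ h₁₂ h₂₁,
      integral_prodQuadForm_eq_of_mem_couplings hμ hν hmem h₁₂ h₂₁]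

lemma cost_eq_objective_jointGaussian (hS : S.PosDef) (hT : T.PosDef) (hε : 0 < ε)
    (hT₁₂ : (T⁻¹).toBlocks₁₂ = -(ε⁻¹ • Meps ε S)) :
    cost ε S (gaussian T.toBlocks₁₁) (gaussian T.toBlocks₂₂) = objective ε S (jointGaussian T) := by
  refine le_antisymm (iInf₂_le _ (jointGaussian_mem_couplings hT.posSemidef))
    (le_iInf₂ fun π hπ ↦ ?_)
  rw [objective_eq_add_klDiv hS hT hε hT₁₂ hπ]
  exact le_self_add

lemma objective_jointGaussian_ne_top (hS : S.PosDef) (hT : T.PosDef) (ε : ℝ) :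
    objective ε S (jointGaussian T) ≠ ∞ := by
  have hLp := memLp_id_of_mem_couplings (memLp_id_gaussian _) (memLp_id_gaussian _)
    (jointGaussian_mem_couplings hT.posSemidef)
  refine ENNReal.add_ne_top.2 ⟨?_, ENNReal.mul_ne_top ENNReal.ofReal_ne_top ?_⟩
  · simp only [norm_sub_sq_eq_prodQuadForm]
    exact (integrable_prodQuadForm hLp _).lintegral_lt_top.ne
  · rw [klDiv_jointGaussian]
    exact klDiv_multivariateGaussian_ne_top hS hT

lemma integral_norm_sub_sq_jointGaussian (hT : T.PosSemidef) :
    ∫ p, ‖p.1 - p.2‖ ^ 2 ∂(jointGaussian T) =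
      T.toBlocks₁₁.trace + T.toBlocks₂₂.trace - 2 * T.toBlocks₁₂.trace := by
  simp only [norm_sub_sq_eq_prodQuadForm]
  rw [integral_prodQuadForm_jointGaussian hT]
  rw [trace_mul_eq_add_of_isHermitian (.fromBlocks isHermitian_one (by simp) isHermitian_one)
    hT.isHermitian]
  simp only [toBlocks_fromBlocks₁₁, toBlocks_fromBlocks₁₂, toBlocks_fromBlocks₂₂, one_mul,
    neg_mul, trace_neg, trace_transpose]
  ring

lemma toReal_objective_jointGaussian (hS : S.PosDef) (hT : T.PosDef) (hε : 0 ≤ ε) :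
    (objective ε S (jointGaussian T)).toReal =
      T.toBlocks₁₁.trace + T.toBlocks₂₂.trace - 2 * T.toBlocks₁₂.trace +
        ε * ((S⁻¹ * T).trace - 2 * d + log S.det - log T.det) := by
  obtain ⟨hcost, hkl⟩ := ENNReal.add_ne_top.1 (objective_jointGaussian_ne_top hS hT ε)
  rw [objective, ENNReal.toReal_add hcost hkl, ENNReal.toReal_mul,
    ENNReal.toReal_ofReal (by positivity), klDiv_jointGaussian,
    toReal_klDiv_multivariateGaussian hS hT,
    ← integral_eq_lintegral_of_nonneg_ae (ae_of_all _ fun p ↦ by positivity) (by fun_prop),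
    integral_norm_sub_sq_jointGaussian hT.posSemidef, Fintype.card_sum, Fintype.card_fin]
  push_cast
  ring

end OptimalCoupling

section RegressionCovariance

variable {m n : Type*} [Fintype m] [Fintype n]

/-- The covariance matrix of a Gaussian pair `(x, y)` with `y ∼ N(0, B)` and
`x | y ∼ N(K M y, ε K)`. The factor `K` in the conditional mean makes the upper right block of
the precision matrix equal to `-ε⁻¹ M`, whatever `K` is. -/
def regressionCov (ε : ℝ) (K : Matrix m m ℝ) (M : Matrix m n ℝ) (B : Matrix n n ℝ) :
    Matrix (m ⊕ n) (m ⊕ n) ℝ :=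
  fromBlocks (K * M * B * Mᵀ * K + ε • K) (K * M * B) (K * M * B)ᵀ B

variable [DecidableEq n] {ε : ℝ} {K : Matrix m m ℝ} {B : Matrix n n ℝ}

lemma schurComplement_regressionCov (hK : K.IsHermitian) (hB : B.PosDef) (M : Matrix m n ℝ) :
    K * M * B * Mᵀ * K + ε • K - K * M * B * B⁻¹ * (K * M * B)ᵀ = ε • K := by
  have hKT : Kᵀ = K := hK
  have hBT : Bᵀ = B := hB.isHermitian
  rw [mul_nonsing_inv_cancel_right _ _ hB.det_pos.ne'.isUnit]
  simp only [transpose_mul, hKT, hBT, Matrix.mul_assoc, add_sub_cancel_left]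

omit [DecidableEq n] in
lemma posDef_regressionCov (hε : 0 < ε) (hK : K.PosDef) (hB : B.PosDef) (M : Matrix m n ℝ) :
    (regressionCov ε K M B).PosDef := by
  classical
  have hschur := schurComplement_regressionCov (ε := ε) hK.isHermitian hB M
  have := hB.isUnit.invertible
  refine PosSemidef.posDef_iff_isUnit ?_ |>.2 ?_
  · rw [regressionCov, ← conjTranspose_eq_transpose_of_trivial (K * M * B),
      PosDef.fromBlocks₂₂ _ _ hB, conjTranspose_eq_transpose_of_trivial, hschur]
    exact (hK.smul hε).posSemidef
  · rw [regressionCov, isUnit_fromBlocks_iff_of_invertible₂₂, invOf_eq_nonsing_inv, hschur]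
    exact (hK.smul hε).isUnit

variable [DecidableEq m]

lemma toBlocks₁₂_inv_regressionCov (hε : 0 < ε) (hK : K.PosDef) (hB : B.PosDef)
    (M : Matrix m n ℝ) : ((regressionCov ε K M B)⁻¹).toBlocks₁₂ = -(ε⁻¹ • M) := by
  have hKinv : (ε • K)⁻¹ = ε⁻¹ • K⁻¹ :=
    inv_eq_left_inv (by
      rw [smul_mul_smul_comm, inv_mul_cancel₀ hε.ne', nonsing_inv_mul _ hK.det_pos.ne'.isUnit,
        one_smul])
  rw [toBlocks₁₂_inv_eq_neg_inv_schur₁₁_mul (posDef_regressionCov hε hK hB M)]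
  simp only [regressionCov, toBlocks_fromBlocks₁₁, toBlocks_fromBlocks₁₂, toBlocks_fromBlocks₂₂]
  rw [schurComplement_regressionCov hK.isHermitian hB, hKinv, Matrix.smul_mul, Matrix.smul_mul,
    Matrix.mul_assoc K M B, nonsing_inv_mul_cancel_left _ _ hK.det_pos.ne'.isUnit,
    mul_nonsing_inv_cancel_right _ _ hB.det_pos.ne'.isUnit]

lemma det_regressionCov (hK : K.IsHermitian) (hB : B.PosDef) (M : Matrix m n ℝ) :
    (regressionCov ε K M B).det = B.det * (ε ^ Fintype.card m * K.det) := by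
  have := hB.isUnit.invertible
  rw [regressionCov, det_fromBlocks₂₂, invOf_eq_nonsing_inv, schurComplement_regressionCov hK hB,
    det_smul]

end RegressionCovariance

section ShiftedRoot

variable {d : ℕ} {ε : ℝ} {A B M : Matrix (Fin d) (Fin d) ℝ}

/-- The matrix `X = (A M B Mᵀ + (ε² / 4) I)^{1/2} + (ε / 2) I`, i.e. the root of
`X (X - ε I) = A M B Mᵀ` for which `X⁻¹ A` is positive definite. -/
noncomputable def shiftedRoot (ε : ℝ) (A B M : Matrix (Fin d) (Fin d) ℝ) :
    Matrix (Fin d) (Fin d) ℝ :=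
  regRoot ε A B M + (ε / 2) • 1

lemma posSemidef_sqrt_mul_mul_sqrt_add (hB : B.PosSemidef) (ε : ℝ)
    (A M : Matrix (Fin d) (Fin d) ℝ) :
    (CFC.sqrt A * M * B * Mᵀ * CFC.sqrt A + (ε ^ 2 / 4) • 1).PosSemidef := by
  have hconj := hB.mul_mul_conjTranspose_same (CFC.sqrt A * M)
  rw [conjTranspose_eq_transpose_of_trivial, transpose_mul, transpose_sqrt, ← mul_assoc] at hconj
  exact hconj.add (PosSemidef.one.smul (by positivity))

lemma regRoot_mul_self (hA : A.PosDef) (hB : B.PosSemidef) (ε : ℝ)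
    (M : Matrix (Fin d) (Fin d) ℝ) :
    regRoot ε A B M * regRoot ε A B M = A * M * B * Mᵀ + (ε ^ 2 / 4) • 1 := by
  have hunit := isUnit_det_sqrt hA
  have hsqrt := CFC.sqrt_mul_sqrt_self _ (posSemidef_sqrt_mul_mul_sqrt_add hB ε A M).nonneg
  have hA_sqrt := CFC.sqrt_mul_sqrt_self A hA.posSemidef.nonneg
  set a := CFC.sqrt A
  set W := a * M * B * Mᵀ * a + (ε ^ 2 / 4) • 1
  calc regRoot ε A B M * regRoot ε A B M
    _ = a * (CFC.sqrt W * CFC.sqrt W) * a⁻¹ := by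
      change a * CFC.sqrt W * a⁻¹ * (a * CFC.sqrt W * a⁻¹) = _
      simp only [mul_assoc, nonsing_inv_mul_cancel_left _ _ hunit]
    _ = a * a * M * B * Mᵀ * (a * a⁻¹) + (ε ^ 2 / 4) • (a * a⁻¹) := by
      rw [hsqrt]
      simp only [W, mul_add, add_mul, mul_assoc, mul_smul_comm, smul_mul_assoc, one_mul]
    _ = A * M * B * Mᵀ + (ε ^ 2 / 4) • 1 := by
      rw [mul_nonsing_inv _ hunit, mul_one, hA_sqrt]

lemma shiftedRoot_mul_sub (hA : A.PosDef) (hB : B.PosSemidef) (ε : ℝ)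
    (M : Matrix (Fin d) (Fin d) ℝ) :
    shiftedRoot ε A B M * (shiftedRoot ε A B M - ε • 1) = A * M * B * Mᵀ := by
  rw [eq_sub_of_add_eq (regRoot_mul_self hA hB ε M).symm, shiftedRoot]
  simp only [add_mul, mul_add, mul_sub, mul_smul_comm, smul_mul_assoc, one_mul, mul_one]
  module

lemma exists_posDef_shiftedRoot_eq (hA : A.PosDef) (hε : 0 < ε)
    (B M : Matrix (Fin d) (Fin d) ℝ) :
    ∃ Q : Matrix (Fin d) (Fin d) ℝ, Q.PosDef ∧
      shiftedRoot ε A B M = CFC.sqrt A * Q * (CFC.sqrt A)⁻¹ := by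
  refine ⟨_, PosDef.posSemidef_add (nonneg_iff_posSemidef.1 (CFC.sqrt_nonneg
    (CFC.sqrt A * M * B * Mᵀ * CFC.sqrt A + (ε ^ 2 / 4) • 1)))
    (PosDef.one.smul (half_pos hε)), ?_⟩
  rw [shiftedRoot, regRoot, mul_add, add_mul, mul_smul_comm, smul_mul_assoc, mul_one,
    mul_nonsing_inv _ (isUnit_det_sqrt hA)]

lemma det_shiftedRoot_pos (hA : A.PosDef) (hε : 0 < ε) (B M : Matrix (Fin d) (Fin d) ℝ) :
    0 < (shiftedRoot ε A B M).det := by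
  obtain ⟨Q, hQ, hX⟩ := exists_posDef_shiftedRoot_eq hA hε B M
  rw [hX, det_conj (posDef_sqrt hA).isUnit]
  exact hQ.det_pos

lemma posDef_inv_shiftedRoot_mul (hA : A.PosDef) (hε : 0 < ε) (B M : Matrix (Fin d) (Fin d) ℝ) :
    ((shiftedRoot ε A B M)⁻¹ * A).PosDef := by
  obtain ⟨Q, hQ, hX⟩ := exists_posDef_shiftedRoot_eq hA hε B M
  have hfactor : (shiftedRoot ε A B M)⁻¹ * A = (CFC.sqrt A)ᴴ * Q⁻¹ * CFC.sqrt A := by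
    nth_rewrite 2 [← CFC.sqrt_mul_sqrt_self A hA.posSemidef.nonneg]
    rw [hX, Matrix.mul_inv_rev, Matrix.mul_inv_rev, nonsing_inv_nonsing_inv _ (isUnit_det_sqrt hA),
      conjTranspose_eq_transpose_of_trivial, transpose_sqrt]
    simp only [mul_assoc, nonsing_inv_mul_cancel_left _ _ (isUnit_det_sqrt hA)]
  rw [hfactor]
  exact hQ.inv.conjTranspose_mul_mul_same (mulVec_injective_of_isUnit (posDef_sqrt hA).isUnit)

lemma inv_shiftedRoot_mul_mul (hA : A.PosDef) (hB : B.PosSemidef) (hε : 0 < ε)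
    (M : Matrix (Fin d) (Fin d) ℝ) :
    (shiftedRoot ε A B M)⁻¹ * A * M * B * Mᵀ = shiftedRoot ε A B M - ε • 1 := by
  have hunit := (det_shiftedRoot_pos hA hε B M).ne'.isUnit
  rw [← nonsing_inv_mul_cancel_left _ (shiftedRoot ε A B M - ε • 1) hunit,
    shiftedRoot_mul_sub hA hB]
  simp only [mul_assoc]

end ShiftedRoot

section OptimalCovariance

variable {d : ℕ} {ε : ℝ} {A B : Matrix (Fin d) (Fin d) ℝ}

/-- The covariance matrix of the optimal coupling of `N(A)` and `N(B)`: the conditional covariance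
`ε K` of the first component given the second has `K = X⁻¹ A`, where `X` is the `shiftedRoot`. -/
noncomputable def optimalCov (ε : ℝ) (A B M : Matrix (Fin d) (Fin d) ℝ) :
    Matrix (Fin d ⊕ Fin d) (Fin d ⊕ Fin d) ℝ :=
  regressionCov ε ((shiftedRoot ε A B M)⁻¹ * A) M B

lemma toBlocks₁₁_optimalCov (hA : A.PosDef) (hB : B.PosSemidef) (hε : 0 < ε)
    (M : Matrix (Fin d) (Fin d) ℝ) : (optimalCov ε A B M).toBlocks₁₁ = A := by
  have hunit := (det_shiftedRoot_pos hA hε B M).ne'.isUnit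
  rw [optimalCov, regressionCov, toBlocks_fromBlocks₁₁, inv_shiftedRoot_mul_mul hA hB hε, sub_mul,
    mul_nonsing_inv_cancel_left _ _ hunit, smul_mul_assoc, one_mul, sub_add_cancel]

lemma posDef_optimalCov (hA : A.PosDef) (hB : B.PosDef) (hε : 0 < ε)
    (M : Matrix (Fin d) (Fin d) ℝ) : (optimalCov ε A B M).PosDef :=
  posDef_regressionCov hε (posDef_inv_shiftedRoot_mul hA hε B M) hB M

lemma toBlocks₁₂_inv_optimalCov (hA : A.PosDef) (hB : B.PosDef) (hε : 0 < ε)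
    (M : Matrix (Fin d) (Fin d) ℝ) : ((optimalCov ε A B M)⁻¹).toBlocks₁₂ = -(ε⁻¹ • M) :=
  toBlocks₁₂_inv_regressionCov hε (posDef_inv_shiftedRoot_mul hA hε B M) hB M

lemma trace_mul_transpose_toBlocks₁₂_optimalCov (hA : A.PosDef) (hB : B.PosDef) (hε : 0 < ε)
    (M : Matrix (Fin d) (Fin d) ℝ) :
    (M * ((optimalCov ε A B M).toBlocks₁₂)ᵀ).trace = (regRoot ε A B M).trace - ε / 2 * d := by
  have hBT : Bᵀ = B := hB.isHermitian
  have hKT : ((shiftedRoot ε A B M)⁻¹ * A)ᵀ = (shiftedRoot ε A B M)⁻¹ * A :=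
    (posDef_inv_shiftedRoot_mul hA hε B M).isHermitian
  calc (M * ((optimalCov ε A B M).toBlocks₁₂)ᵀ).trace
    _ = ((shiftedRoot ε A B M)⁻¹ * A * M * B * Mᵀ).trace := by
      rw [optimalCov, regressionCov, toBlocks_fromBlocks₁₂, transpose_mul, transpose_mul, hBT, hKT,
        ← mul_assoc, ← mul_assoc, trace_mul_comm]
      simp only [mul_assoc]
    _ = (regRoot ε A B M).trace - ε / 2 * d := by
      rw [inv_shiftedRoot_mul_mul hA hB.posSemidef hε, shiftedRoot, trace_sub, trace_add,
        trace_smul, trace_smul, trace_one, Fintype.card_fin, smul_eq_mul, smul_eq_mul]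
      ring

lemma log_det_optimalCov (hA : A.PosDef) (hB : B.PosDef) (hε : 0 < ε)
    (M : Matrix (Fin d) (Fin d) ℝ) :
    log (optimalCov ε A B M).det =
      d * log ε + log (A * B).det - log (shiftedRoot ε A B M).det := by
  have hX := det_shiftedRoot_pos hA hε B M
  have hA₀ := hA.det_pos
  have hB₀ := hB.det_pos
  have hdet : (optimalCov ε A B M).det =
      ε ^ d * (A * B).det / (shiftedRoot ε A B M).det := by
    rw [optimalCov, det_regressionCov (posDef_inv_shiftedRoot_mul hA hε B M).isHermitian hB,
      det_mul, det_mul, det_nonsing_inv, Ring.inverse_eq_inv', Fintype.card_fin]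
    ring
  have hAB : 0 < (A * B).det := det_mul A B ▸ mul_pos hA₀ hB₀
  rw [hdet, Real.log_div (by positivity) hX.ne', Real.log_mul (by positivity) hAB.ne', Real.log_pow]

lemma toReal_objective_optimalCov {S : Matrix (Fin d ⊕ Fin d) (Fin d ⊕ Fin d) ℝ} (hS : S.PosDef)
    (hA : A.PosDef) (hB : B.PosDef) (hε : 0 < ε) :
    (objective ε S (jointGaussian (optimalCov ε A B (Meps ε S)))).toReal =
      A.trace + B.trace - 2 * (regRoot ε A B (Meps ε S)).trace
        + ε * log (shiftedRoot ε A B (Meps ε S)).det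
        + ε * ((S⁻¹).toBlocks₁₁ * A).trace + ε * ((S⁻¹).toBlocks₂₂ * B).trace
        - ε * log (A * B).det - ε * d - ε * d * log ε - ε * log (S⁻¹).det := by
  set T := optimalCov ε A B (Meps ε S) with hTdef
  have hT : T.PosDef := posDef_optimalCov hA hB hε _
  have h₁₁ : T.toBlocks₁₁ = A := toBlocks₁₁_optimalCov hA hB.posSemidef hε _
  have h₂₂ : T.toBlocks₂₂ = B := rfl
  have hcross : T.toBlocks₁₂.trace - ε * ((S⁻¹).toBlocks₁₂ * (T.toBlocks₁₂)ᵀ).trace =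
      (regRoot ε A B (Meps ε S)).trace - ε / 2 * d := by
    rw [← trace_mul_transpose_toBlocks₁₂_optimalCov hA hB hε (Meps ε S), ← hTdef]
    simp only [Meps, sub_mul, one_mul, smul_mul_assoc, trace_sub, trace_transpose, trace_smul,
      smul_eq_mul]
  have hlog_inv : log (S⁻¹).det = -log S.det := by
    rw [det_nonsing_inv, Ring.inverse_eq_inv', Real.log_inv]
  rw [toReal_objective_jointGaussian hS hT hε.le,
    trace_mul_eq_add_of_isHermitian hS.inv.isHermitian hT.isHermitian, h₁₁, h₂₂, hlog_inv,
    log_det_optimalCov hA hB hε]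
  linear_combination -2 * hcross

lemma cost_gaussian_eq_objective {S : Matrix (Fin d ⊕ Fin d) (Fin d ⊕ Fin d) ℝ} (hS : S.PosDef)
    (hA : A.PosDef) (hB : B.PosDef) (hε : 0 < ε) :
    cost ε S (gaussian A) (gaussian B) =
      objective ε S (jointGaussian (optimalCov ε A B (Meps ε S))) := by
  have hcost := cost_eq_objective_jointGaussian hS (posDef_optimalCov hA hB hε _) hε
    (toBlocks₁₂_inv_optimalCov hA hB hε _)
  rwa [toBlocks₁₁_optimalCov hA hB.posSemidef hε] at hcost

end OptimalCovariance

end GaussianEOT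

theorem mainTheorem2 (d : ℕ) (A B : Matrix (Fin d) (Fin d) ℝ) (hA : A.PosDef) (hB : B.PosDef)
    (S : Matrix (Fin d ⊕ Fin d) (Fin d ⊕ Fin d) ℝ) (hS : S.PosDef) (ε : ℝ) (hε : 0 < ε) :
    GaussianEOT.cost ε S (GaussianEOT.gaussian A) (GaussianEOT.gaussian B) ≠ ∞ ∧
    (GaussianEOT.cost ε S (GaussianEOT.gaussian A) (GaussianEOT.gaussian B)).toReal =
      A.trace + B.trace
        - 2 * (GaussianEOT.regRoot ε A B (GaussianEOT.Meps ε S)).trace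
        + ε * Real.log
            (GaussianEOT.regRoot ε A B (GaussianEOT.Meps ε S) + (ε / 2) • 1).det
        + ε * ((S⁻¹).toBlocks₁₁ * A).trace
        + ε * ((S⁻¹).toBlocks₂₂ * B).trace
        - ε * Real.log (A * B).det
        - ε * d
        - ε * d * Real.log ε
        - ε * Real.log (S⁻¹).det ∧
    GaussianEOT.Meps ε S =
      1 + ε • ((S.toBlocks₁₁)⁻¹ * S.toBlocks₁₂ *
        (S.toBlocks₂₂ - (S.toBlocks₁₂)ᵀ * (S.toBlocks₁₁)⁻¹ * S.toBlocks₁₂)⁻¹) := by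
  refine ⟨?_, ?_, ?_⟩
  · rw [GaussianEOT.cost_gaussian_eq_objective hS hA hB hε]
    exact GaussianEOT.objective_jointGaussian_ne_top hS
      (GaussianEOT.posDef_optimalCov hA hB hε _) ε
  · rw [GaussianEOT.cost_gaussian_eq_objective hS hA hB hε]
    exact GaussianEOT.toReal_objective_optimalCov hS hA hB hε
  · rw [GaussianEOT.Meps, GaussianEOT.toBlocks₁₂_inv_eq_neg_mul_inv_schur₂₂ hS, smul_neg,
      sub_neg_eq_add]
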